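/- **Setting.** Let $f(x,u)=f_0(x,u)+\sum_{j=1}^S\theta_j f_j(x,u)$ with $f_j:\mathbb R^n\times\mathbb R^m\to\mathbb R^n$ and a known parameter $\theta\in\mathbb R^S$. Let $\varphi(x,u)\in\mathbb R^{S\times n}$ be the matrix whose $j$-th row is $f_j(x,u)^\top$, $j=1,\dots,S$, and write $\varphi_i=\varphi(x_i,u_i)$ along a sequence. Norms are Euclidean and $|z|_P^2=z^\top Pz$. *Persistent excitation (PE).* For $M\ge 1$, a sequence $\{x_k,u_k\}_{k\ge0}$ is PE for all $k\ge k_0$ if there are constants $\alpha,\beta>0$ with $\alpha I_S\le\sum_{i=j}^{j+M-1}\varphi_i\varphi_i^\top\le\beta I_S$ for all $j\ge k_0$. *Reference.* $\{x_r(k),u_r(k)\}_{k\ge0}$ is a feasible period-$M$ sequence, i.e. $x_r(k+1)=f(x_r(k),u_r(k))$, $x_r(k+M)=x_r(k)$, $u_r(k+M)=u_r(k)$ for all $k$, and it is PE for all $k\ge0$ (with window length equal to the period $M$). *MPC.* Let $Q,R$ be symmetric positive definite. For a horizon $N\geq 1$, a state $x$, a time $k$ and $\mathbf u^N=(u_{0|k},\dots,u_{N-1|k})$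 put $x_{0|k}=x$, $x_{i+1|k}=f(x_{i|k},u_{i|k})$ and $$J_N(x,\mathbf u^N,k)=\sum_{i=0}^{N-1}\Big(|x_{i|k}-x_r(k+i)|_Q^2+|u_{i|k}-u_r(k+i)|_R^2\Big).$$ A closed-loop sequence with disturbance $\{w_k\}$ is a sequence $\{x_k,u_k\}_{k\ge0}$ such that, for every $k$, $u_k$ is the first element of a minimizer of $J_N(x_k,\cdot,k)$ and $x_{k+1}=f(x_k,u_k)+w_k$. **Assumptions.** 1. $f_0,\dots,f_S$ are twice continuously differentiable. 2. For every horizon $N\ge1$ and every $k$, the Hessian of $\mathbf u^N\mapsto J_N(x_r(k),\mathbf u^N,k)$ at each of its minimizers is positive definite. 3. There are $\kappa:\mathbb R^n\times\mathbb R^n\times\mathbb R^m\to\mathbb R^m$, a function $V_\delta:\mathbb R^n\times\mathbb R^n\times\mathbb R^m\to\mathbb R_{\ge0}$ that is continuous in its first argument with $V_\delta(x',x',u')=0$ for all $(x',u')$, and constants $c_{\delta,l},c_{\delta,u},\delta_{loc},k_{max}>0$, $\rho\in(0,1)$ such that, for all $(x,x',u')$ with $V_\delta(x,x',u')\le\delta_{loc}$,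 $$c_{\delta,l}|x-x'|^2\le V_\delta(x,x',u')\le c_{\delta,u}|x-x'|^2,\qquad |\kappa(x,x',u')-u'|\le k_{max}|x-x'|,$$ $$V_\delta\big(f(x,\kappa(x,x',u')),f(x',u'),u'^+\big)\le\rho V_\delta(x,x',u')\quad\text{for all }u'^+\in\mathbb R^m.$$ **Claim.** For every $c_x>0$ there is $N_0\ge1$ such that for every horizon $N\ge N_0$ the function $J_N(x,\cdot,k)$ has a minimizer for all $x$ and $k$, and there is $\bar w>0$ with the following property. For every closed-loop sequence $\{x_k,u_k\}$ of horizon $N$ with $|x_0-x_r(0)|\le c_x$ and $|w_k|\le\bar w$ for all $k$, there is $k_{PE}\in\mathbb N_{\geq 0}$ such that - $\{x_k,u_k\}$ is PE for all $k\ge k_{PE}$; - for every $\bar k\ge k_{PE}$ with $\bar k \bmod M=0$, every closed-loop sequence of horizon $N$ that starts at time $0$ in the state $x_{\bar k}$ and is subject to any disturbance bounded by $\bar w$ is PE for all $k\ge0$. -/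

import Mathlib

namespace PEMPC

/-- Real column vectors with the Euclidean norm. -/
abbrev Vec (d : ℕ) := EuclideanSpace ℝ (Fin d)

/-- The nominal dynamics `f(x,u) = f₀(x,u) + ∑ j, θ j * f j (x,u)`. -/
noncomputable def dyn {n m S : ℕ} (f₀ : Vec n → Vec m → Vec n)
    (fb : Fin S → Vec n → Vec m → Vec n) (θ : Vec S) (x : Vec n) (u : Vec m) : Vec n :=
  f₀ x u + ∑ j, θ j • fb j x u

/-- The `S × n` regressor `φ(x,u)`; its `j`-th row is `f j (x,u)`. -/
def regressor {n m S : ℕ} (fb : Fin S → Vec n → Vec m → Vec n) (x : Vec n) (u : Vec m) :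
    Matrix (Fin S) (Fin n) ℝ :=
  Matrix.of fun j i => fb j x u i

/-- The sequence `(x, u)` is persistently exciting, with window length `M`, for all times
`k ≥ k₀`: there are constants `α, β > 0` such that
`α I ≤ ∑_{i=j}^{j+M-1} φ_i φ_iᵀ ≤ β I` for all `j ≥ k₀`. -/
def IsPEFrom {n m S : ℕ} (fb : Fin S → Vec n → Vec m → Vec n) (M k₀ : ℕ)
    (x : ℕ → Vec n) (u : ℕ → Vec m) : Prop :=
  ∃ α β : ℝ, 0 < α ∧ 0 < β ∧ ∀ j ≥ k₀,
    ((∑ i ∈ Finset.range M, regressor fb (x (j + i)) (u (j + i)) *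
        (regressor fb (x (j + i)) (u (j + i))).transpose) -
      α • (1 : Matrix (Fin S) (Fin S) ℝ)).PosSemidef ∧
    (β • (1 : Matrix (Fin S) (Fin S) ℝ) -
      ∑ i ∈ Finset.range M, regressor fb (x (j + i)) (u (j + i)) *
        (regressor fb (x (j + i)) (u (j + i))).transpose).PosSemidef

/-- A feasible period-`M` sequence of the undisturbed system `x⁺ = g(x,u)`. -/
def IsFeasiblePeriodic {n m : ℕ} (g : Vec n → Vec m → Vec n) (M : ℕ)
    (xr : ℕ → Vec n) (ur : ℕ → Vec m) : Prop :=
  0 < M ∧ (∀ k, xr (k + 1) = g (xr k) (ur k)) ∧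
    (∀ k, xr (k + M) = xr k) ∧ (∀ k, ur (k + M) = ur k)

/-- The weighted square `|z|_P² = zᵀ P z`. -/
noncomputable def wsq {d : ℕ} (P : Matrix (Fin d) (Fin d) ℝ) (z : Vec d) : ℝ :=
  z.ofLp ⬝ᵥ P.mulVec z.ofLp

/-- The state predicted `i` steps ahead from `x` under the inputs `v 0, v 1, …`. -/
def predict {n m : ℕ} (g : Vec n → Vec m → Vec n) (x : Vec n) (v : ℕ → Vec m) : ℕ → Vec n
  | 0 => x
  | i + 1 => g (predict g x v i) (v i)

/-- Extension of a length-`N` input sequence by zero (the prediction over the horizon never uses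
the added entries). -/
def extend {m N : ℕ} (U : Fin N → Vec m) (i : ℕ) : Vec m :=
  if h : i < N then U ⟨i, h⟩ else 0

/-- The tracking cost
`J_N(x, U, k) = ∑_{i<N} |x_{i|k} - x_r(k+i)|_Q² + |u_{i|k} - u_r(k+i)|_R²`. -/
noncomputable def cost {n m : ℕ} (g : Vec n → Vec m → Vec n) (Q : Matrix (Fin n) (Fin n) ℝ)
    (R : Matrix (Fin m) (Fin m) ℝ) (xr : ℕ → Vec n) (ur : ℕ → Vec m) (N : ℕ)
    (x : Vec n) (U : Fin N → Vec m) (k : ℕ) : ℝ :=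
  ∑ i : Fin N, (wsq Q (predict g x (extend U) i - xr (k + i)) + wsq R (U i - ur (k + i)))

/-- `U` is a minimizing control sequence of the horizon-`N` problem at state `x` and time `k`. -/
def IsMinimizer {n m : ℕ} (g : Vec n → Vec m → Vec n) (Q : Matrix (Fin n) (Fin n) ℝ)
    (R : Matrix (Fin m) (Fin m) ℝ) (xr : ℕ → Vec n) (ur : ℕ → Vec m) (N : ℕ)
    (x : Vec n) (k : ℕ) (U : Fin N → Vec m) : Prop :=
  ∀ U' : Fin N → Vec m, cost g Q R xr ur N x U k ≤ cost g Q R xr ur N x U' k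

/-- The Hessian of `U ↦ J_N(x_r(k), U, k)` at every minimizing control sequence at the reference
state `x_r(k)` is positive definite. -/
def HessianPosDef {n m : ℕ} (g : Vec n → Vec m → Vec n) (Q : Matrix (Fin n) (Fin n) ℝ)
    (R : Matrix (Fin m) (Fin m) ℝ) (xr : ℕ → Vec n) (ur : ℕ → Vec m) (N : ℕ) : Prop :=
  ∀ (k : ℕ) (U : Fin N → Vec m), IsMinimizer g Q R xr ur N (xr k) k U →
    ∀ v : Fin N → Vec m, v ≠ 0 →
      0 < fderiv ℝ (fderiv ℝ fun W : Fin N → Vec m => cost g Q R xr ur N (xr k) W k) U v v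

/-- Local incremental stabilizability of `x⁺ = g(x,u)`. -/
def LocIncrStabilizable {n m : ℕ} (g : Vec n → Vec m → Vec n) : Prop :=
  ∃ (κ : Vec n → Vec n → Vec m → Vec m) (V : Vec n → Vec n → Vec m → ℝ)
    (cl cu δloc kmax ρ : ℝ),
    0 < cl ∧ 0 < cu ∧ 0 < δloc ∧ 0 < kmax ∧ 0 < ρ ∧ ρ < 1 ∧
    (∀ x x' u', 0 ≤ V x x' u') ∧
    (∀ x' u', Continuous fun x => V x x' u') ∧
    (∀ x' u', V x' x' u' = 0) ∧
    ∀ x x' u', V x x' u' ≤ δloc →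
      cl * ‖x - x'‖ ^ 2 ≤ V x x' u' ∧ V x x' u' ≤ cu * ‖x - x'‖ ^ 2 ∧
      ‖κ x x' u' - u'‖ ≤ kmax * ‖x - x'‖ ∧
      ∀ u'' : Vec m, V (g x (κ x x' u')) (g x' u') u'' ≤ ρ * V x x' u'

/-- `(x, u)` is a closed-loop sequence of the horizon-`N` MPC under the disturbance `w`: at every
time `k` the input `u k` is the first element of a minimizing control sequence at `(x k, k)`,
and `x (k+1) = g (x k, u k) + w k`. -/
def IsClosedLoop {n m : ℕ} (g : Vec n → Vec m → Vec n) (Q : Matrix (Fin n) (Fin n) ℝ)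
    (R : Matrix (Fin m) (Fin m) ℝ) (xr : ℕ → Vec n) (ur : ℕ → Vec m) (N : ℕ)
    (x : ℕ → Vec n) (u : ℕ → Vec m) (w : ℕ → Vec n) : Prop :=
  ∀ k, (∃ (hN : 0 < N) (U : Fin N → Vec m),
      IsMinimizer g Q R xr ur N (x k) k U ∧ u k = U ⟨0, hN⟩) ∧
    x (k + 1) = g (x k) (u k) + w k

end PEMPC

open Filter Topology

namespace PEMPC

/-! ### Quadratic weights versus Euclidean norms. -/

section Weights

variable {d : ℕ} (P : Matrix (Fin d) (Fin d) ℝ)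

/-! The optimal cost serves as a Lyapunov function along the closed loop, although the MPC has no
terminal ingredients.

Incremental stabilizability becomes global by chaining along segments
(`LocIncrStabilizable.exists_track_global`). Any state can therefore be steered onto the reference
at a total cost of at most `γ` times its first state cost, with `γ` independent of the horizon
(`exists_cost_controllability`). For a long horizon, the tail of an optimal prediction is then
geometrically small. Replacing its end by a steering input shows that the optimal cost contracts by
`1 - 1 / (2γ)` per nominal step (`exists_seqCost_decrease`).

The optimal cost tolerates small state errors uniformly on sublevel sets (`exists_value_le_add`), so
under small disturbances it enters any prescribed small sublevel set and stays there
(`exists_ultimate_bound`). It also dominates the first stage cost, so in such a set both the state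
and the applied input are close to the reference; continuity of the minimizers is never needed.
Excitation of a periodic reference survives small perturbations (`IsPEFrom.exists_of_near`), which
finishes the proof. -/

theorem continuous_wsq : Continuous (wsq P) := by
  unfold wsq
  fun_prop

theorem wsq_zero : wsq P 0 = 0 := by simp [wsq]

theorem wsq_smul (c : ℝ) (z : Vec d) : wsq P (c • z) = c ^ 2 * wsq P z := by
  simp [wsq, Matrix.mulVec_smul]
  ring

variable {P}

theorem wsq_pos (hP : P.PosDef) {z : Vec d} (hz : z ≠ 0) : 0 < wsq P z := by
  have h : z.ofLp ≠ 0 := fun h => hz (by ext i; simp [h])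
  simpa [wsq] using hP.dotProduct_mulVec_pos h

theorem wsq_nonneg (hP : P.PosDef) (z : Vec d) : 0 ≤ wsq P z := by
  rcases eq_or_ne z 0 with rfl | hz
  · simp [wsq_zero]
  · exact (wsq_pos hP hz).le

/-- A positive definite weight is equivalent to the squared Euclidean norm. -/
theorem exists_wsq_bounds (hP : P.PosDef) : ∃ a b : ℝ, 0 < a ∧ 0 < b ∧
    ∀ z : Vec d, a * ‖z‖ ^ 2 ≤ wsq P z ∧ wsq P z ≤ b * ‖z‖ ^ 2 := by
  have hc : IsCompact (Metric.sphere (0 : Vec d) 1) := isCompact_sphere 0 1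
  -- The unit sphere is empty exactly in dimension zero, where no extremum over it exists.
  rcases (Metric.sphere (0 : Vec d) 1).eq_empty_or_nonempty with he | hne
  · have hz : ∀ z : Vec d, z = 0 := by
      intro z
      by_contra hz
      have : ‖z‖⁻¹ • z ∈ Metric.sphere (0 : Vec d) 1 := by
        simp [norm_smul, norm_ne_zero_iff.2 hz]
      simp [he] at this
    exact ⟨1, 1, one_pos, one_pos, fun z => by simp [hz z, wsq_zero]⟩
  · obtain ⟨y, hy, hy'⟩ := hc.exists_isMinOn hne (continuous_wsq P).continuousOn
    obtain ⟨Y, hY, hY'⟩ := hc.exists_isMaxOn hne (continuous_wsq P).continuousOn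
    have hne0 : ∀ w ∈ Metric.sphere (0 : Vec d) 1, w ≠ 0 := by
      rintro w hw rfl
      simp at hw
    refine ⟨wsq P y, wsq P Y, wsq_pos hP (hne0 y hy), wsq_pos hP (hne0 Y hY), fun z => ?_⟩
    rcases eq_or_ne z 0 with rfl | hz
    · simp [wsq_zero]
    have hz' : ‖z‖ ≠ 0 := norm_ne_zero_iff.2 hz
    have hmem : ‖z‖⁻¹ • z ∈ Metric.sphere (0 : Vec d) 1 := by simp [norm_smul, hz']
    have hw : wsq P z = wsq P (‖z‖⁻¹ • z) * ‖z‖ ^ 2 := by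
      rw [wsq_smul]
      field_simp
    rw [hw]
    exact ⟨mul_le_mul_of_nonneg_right (hy' hmem) (sq_nonneg _),
      mul_le_mul_of_nonneg_right (hY' hmem) (sq_nonneg _)⟩

end Weights

/-! ### Dynamic programming and decrease of the optimal cost. -/

section SequenceCost

variable {n m : ℕ}

theorem predict_congr (g : Vec n → Vec m → Vec n) (x : Vec n) {v v' : ℕ → Vec m} {j : ℕ}
    (h : ∀ i < j, v i = v' i) : predict g x v j = predict g x v' j := by
  induction j with
  | zero => rfl
  | succ j ih =>
    simp only [predict]
    rw [ih fun i hi => h i (by omega), h j (by omega)]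

theorem predict_add (g : Vec n → Vec m → Vec n) (x : Vec n) (v : ℕ → Vec m) (a b : ℕ) :
    predict g x v (a + b) = predict g (predict g x v a) (fun i => v (a + i)) b := by
  induction b with
  | zero => rfl
  | succ b ih => rw [← add_assoc]; simp only [predict]; rw [ih]

/-- The stage cost relative to the reference at time `k`. -/
noncomputable def stageCost (Q : Matrix (Fin n) (Fin n) ℝ)
    (R : Matrix (Fin m) (Fin m) ℝ) (xr : ℕ → Vec n) (ur : ℕ → Vec m)
    (x : Vec n) (u : Vec m) (k : ℕ) : ℝ :=
  wsq Q (x - xr k) + wsq R (u - ur k)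

/-- The tracking cost over the horizon `N` of an infinite input sequence. -/
noncomputable def seqCost (g : Vec n → Vec m → Vec n) (Q : Matrix (Fin n) (Fin n) ℝ)
    (R : Matrix (Fin m) (Fin m) ℝ) (xr : ℕ → Vec n) (ur : ℕ → Vec m)
    (x : Vec n) (v : ℕ → Vec m) (k N : ℕ) : ℝ :=
  ∑ i ∈ Finset.range N, stageCost Q R xr ur (predict g x v i) (v i) (k + i)

variable (g : Vec n → Vec m → Vec n) (Q : Matrix (Fin n) (Fin n) ℝ)
    (R : Matrix (Fin m) (Fin m) ℝ) (xr : ℕ → Vec n) (ur : ℕ → Vec m)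

theorem seqCost_congr (x : Vec n) {v v' : ℕ → Vec m} (k : ℕ) {N : ℕ}
    (h : ∀ i < N, v i = v' i) :
    seqCost g Q R xr ur x v k N = seqCost g Q R xr ur x v' k N := by
  refine Finset.sum_congr rfl fun i hi => ?_
  rw [Finset.mem_range] at hi
  rw [predict_congr g x fun j hj => h j (hj.trans hi), h i hi]

theorem seqCost_add (x : Vec n) (v : ℕ → Vec m) (k a b : ℕ) :
    seqCost g Q R xr ur x v k (a + b) = seqCost g Q R xr ur x v k a +
      seqCost g Q R xr ur (predict g x v a) (fun i => v (a + i)) (k + a) b := by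
  simp only [seqCost, Finset.sum_range_add, predict_add, add_assoc]

/-- The first `j` entries of `v`, followed by `b`. -/
def splice (j : ℕ) (v b : ℕ → Vec m) (i : ℕ) : Vec m := if i < j then v i else b (i - j)

/-- Source of all competitors to an optimal sequence: after a switch at time `j`, only the state
reached there matters. -/
theorem seqCost_splice (x : Vec n) (v b : ℕ → Vec m) (k j L : ℕ) :
    seqCost g Q R xr ur x (splice j v b) k (j + L) = seqCost g Q R xr ur x v k j +
      seqCost g Q R xr ur (predict g x v j) b (k + j) L := by
  have h : ∀ i < j, splice j v b i = v i := fun i hi => by simp [splice, hi]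
  have h' : (fun i => splice j v b (j + i)) = b := by
    funext i
    simp [splice]
  rw [seqCost_add, seqCost_congr g Q R xr ur x k h, predict_congr g x h, h']

theorem extend_apply {N : ℕ} (U : Fin N → Vec m) (i : Fin N) : extend U i = U i := by
  simp [extend]

theorem cost_eq_seqCost {N : ℕ} (x : Vec n) (U : Fin N → Vec m) (k : ℕ) :
    cost g Q R xr ur N x U k = seqCost g Q R xr ur x (extend U) k N := by
  rw [cost, seqCost, ← Fin.sum_univ_eq_sum_range]
  simp only [stageCost, extend_apply]

theorem seqCost_eq_cost {N : ℕ} (x : Vec n) (v : ℕ → Vec m) (k : ℕ) :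
    seqCost g Q R xr ur x v k N = cost g Q R xr ur N x (fun i => v i) k := by
  rw [cost_eq_seqCost]
  exact seqCost_congr g Q R xr ur x k fun i hi => by simp [extend, hi]

variable {g Q R xr ur}

theorem stageCost_nonneg (hQ : Q.PosDef) (hR : R.PosDef) (x : Vec n) (u : Vec m) (k : ℕ) :
    0 ≤ stageCost Q R xr ur x u k :=
  add_nonneg (wsq_nonneg hQ _) (wsq_nonneg hR _)

theorem seqCost_nonneg (hQ : Q.PosDef) (hR : R.PosDef) (x : Vec n) (v : ℕ → Vec m) (k N : ℕ) :
    0 ≤ seqCost g Q R xr ur x v k N :=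
  Finset.sum_nonneg fun _ _ => stageCost_nonneg hQ hR _ _ _

/-- Without terminal ingredients, exponential cost controllability makes the optimal cost decrease
along the optimal prediction once the horizon is long enough. -/
theorem exists_seqCost_decrease (hQ : Q.PosDef) (hR : R.PosDef) {γ : ℝ} (hγ : 1 ≤ γ)
    (hB : ∀ x k, ∃ v, ∀ L, seqCost g Q R xr ur x v k L ≤ γ * wsq Q (x - xr k))
    {p : ℕ} (hp : γ ^ 2 * (1 - 1 / γ) ^ (p + 1) ≤ 1 / 2) (x : Vec n) (k : ℕ) (v : ℕ → Vec m)
    (hopt : ∀ v', seqCost g Q R xr ur x v k (p + 2) ≤ seqCost g Q R xr ur x v' k (p + 2)) :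
    ∃ v', seqCost g Q R xr ur (g x (v 0)) v' (k + 1) (p + 2) ≤
      (1 - 1 / (2 * γ)) * seqCost g Q R xr ur x v k (p + 2) := by
  have hγ0 : 0 < γ := by linarith
  set C : ℕ → ℝ := fun j => seqCost g Q R xr ur x v k j with hC
  have hsucc : ∀ j, C (j + 1) =
      C j + stageCost Q R xr ur (predict g x v j) (v j) (k + j) := fun j =>
    Finset.sum_range_succ _ _
  have hqle : ∀ j, wsq Q (predict g x v j - xr (k + j)) ≤ C (j + 1) - C j := fun j => by
    have := wsq_nonneg hR (v j - ur (k + j))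
    rw [hsucc, stageCost]
    linarith
  -- Principle of optimality: the optimal tail costs no more than steering from the `j`-th predicted
  -- state, hence at most `γ` times the `j`-th stage cost.
  have htail : ∀ j ≤ p + 2, C (p + 2) - C j ≤ γ * (C (j + 1) - C j) := by
    intro j hj
    obtain ⟨b, hb⟩ := hB (predict g x v j) (k + j)
    obtain ⟨L, hL⟩ := Nat.exists_eq_add_of_le hj
    have h1 := hopt (splice j v b)
    rw [hL, seqCost_splice, ← hL] at h1
    have h2 := hb L
    have h3 := mul_le_mul_of_nonneg_left (hqle j) hγ0.le
    simp only [hC] at h3 ⊢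
    linarith
  -- Each stage thus removes at least the fraction `1 / γ` of the remaining cost.
  have hgeo : ∀ j ≤ p + 2, C (p + 2) - C j ≤ (1 - 1 / γ) ^ j * C (p + 2) := by
    intro j
    induction j with
    | zero => simp [hC, seqCost]
    | succ j ih =>
      intro hj
      have h1 := ih (by omega)
      have h2 := htail j (by omega)
      have h3 : (C (p + 2) - C j) / γ ≤ C (j + 1) - C j := by
        rw [div_le_iff₀ hγ0]; linarith
      have h4 : 0 ≤ 1 - 1 / γ := by
        rw [sub_nonneg, div_le_one hγ0]; exact hγ
      calc C (p + 2) - C (j + 1) ≤ (1 - 1 / γ) * (C (p + 2) - C j) := by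
            have : (1 - 1 / γ) * (C (p + 2) - C j) =
              (C (p + 2) - C j) - (C (p + 2) - C j) / γ := by ring
            linarith
        _ ≤ (1 - 1 / γ) * ((1 - 1 / γ) ^ j * C (p + 2)) := mul_le_mul_of_nonneg_left h1 h4
        _ = _ := by ring
  have hC0 : C 0 = 0 := by simp [hC, seqCost]
  have ht0 := htail 0 (by omega)
  have htl := hgeo (p + 1) (by omega)
  rw [hC0, sub_zero, sub_zero, zero_add] at ht0
  obtain ⟨b, hb⟩ := hB (predict g x v (p + 1)) (k + (p + 1))
  -- Drop the first input and steer during the last two stages. The switch is at the last state that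
  -- the cost charges, number `p + 1`, whose weight is therefore controlled by the small tail. The
  -- steering costs at most half of the first stage cost `C 1`, so at least `C 1 / 2 ≥ C (p + 2) /
  -- (2γ)` is gained.
  refine ⟨splice p (fun i => v (1 + i)) b, ?_⟩
  have hpred : predict g (g x (v 0)) (fun i => v (1 + i)) p = predict g x v (p + 1) := by
    rw [add_comm p 1, predict_add]; rfl
  have hsplit : C (p + 1) = C 1 +
      seqCost g Q R xr ur (g x (v 0)) (fun i => v (1 + i)) (k + 1) p := by
    rw [add_comm p 1]
    exact seqCost_add g Q R xr ur x v k 1 p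
  rw [seqCost_splice, hpred, show k + 1 + p = k + (p + 1) by ring]
  have hb2 := hb 2
  have hl := mul_le_mul_of_nonneg_left (hqle (p + 1)) hγ0.le
  have hl1 : 0 ≤ C 1 := seqCost_nonneg hQ hR _ _ _ _
  have hl2 : C (p + 2) - C (p + 1) ≤ (1 - 1 / γ) ^ (p + 1) * (γ * C 1) := by
    refine htl.trans (mul_le_mul_of_nonneg_left ht0 (pow_nonneg ?_ _))
    rw [sub_nonneg, div_le_one hγ0]; exact hγ
  have hl3 : γ * (C (p + 2) - C (p + 1)) ≤ 1 / 2 * C 1 := by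
    calc γ * (C (p + 2) - C (p + 1)) ≤ γ * ((1 - 1 / γ) ^ (p + 1) * (γ * C 1)) :=
          mul_le_mul_of_nonneg_left hl2 hγ0.le
      _ = (γ ^ 2 * (1 - 1 / γ) ^ (p + 1)) * C 1 := by ring
      _ ≤ _ := mul_le_mul_of_nonneg_right hp hl1
  have hl4 : C (p + 1) ≤ C (p + 2) := by
    rw [hsucc (p + 1)]
    linarith [stageCost_nonneg hQ hR (xr := xr) (ur := ur) (predict g x v (p + 1)) (v (p + 1))
      (k + (p + 1))]
  have hl5 : C (p + 2) / (2 * γ) ≤ C 1 / 2 := by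
    rw [div_le_iff₀ (by positivity)]; linarith
  have hgoal : (1 - 1 / (2 * γ)) * C (p + 2) = C (p + 2) - C (p + 2) / (2 * γ) := by ring
  change _ ≤ (1 - 1 / (2 * γ)) * C (p + 2)
  rw [hgoal]
  have hl' : γ * wsq Q (predict g x v (p + 1) - xr (k + (p + 1))) ≤
    γ * (C (p + 2) - C (p + 1)) := hl
  linarith

end SequenceCost

end PEMPC

namespace PEMPC

/-! ### From local stabilizability to global cost controllability. -/

section Controllability

variable {n m : ℕ} {g : Vec n → Vec m → Vec n}

/-- A continuous function vanishing at `x'` that is dominated by `c * ‖x - x'‖ ^ 2` on a sublevel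
set has a ball around `x'` contained in that sublevel set. -/
theorem le_of_quadratic_on_sublevel {W : Vec n → ℝ} (hW : Continuous W) {x' : Vec n}
    (h0 : W x' = 0) {c δ : ℝ} (hc : 0 < c) (hδ : 0 < δ)
    (hle : ∀ x, W x ≤ δ → W x ≤ c * ‖x - x'‖ ^ 2) {x : Vec n} (hx : c * ‖x - x'‖ ^ 2 < δ) :
    W x ≤ δ := by
  by_contra! hcon
  have hcont : ContinuousOn (fun s : ℝ => W (x' + s • (x - x'))) (Set.Icc 0 1) := by fun_prop
  -- If `W x` exceeded `δ`, then `W` would equal `δ` somewhere on the segment from `x'` to `x`,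
  -- where the quadratic bound keeps it below `δ`.
  obtain ⟨s, hs, hs'⟩ := intermediate_value_Icc zero_le_one hcont
    (show δ ∈ Set.Icc _ _ by simpa [h0] using ⟨hδ.le, hcon.le⟩)
  have h1 := hle _ hs'.le
  simp only at hs'
  rw [hs', add_sub_cancel_left, norm_smul, mul_pow, Real.norm_eq_abs, sq_abs] at h1
  have h2 : s ^ 2 ≤ 1 := pow_le_one₀ hs.1 hs.2
  have h3 : c * (s ^ 2 * ‖x - x'‖ ^ 2) ≤ c * ‖x - x'‖ ^ 2 := by
    refine mul_le_mul_of_nonneg_left ?_ hc.le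
    exact mul_le_of_le_one_left (sq_nonneg _) h2
  linarith

/-- Trajectories can be steered exponentially onto every sufficiently close trajectory. -/
theorem LocIncrStabilizable.exists_track (h : LocIncrStabilizable g) :
    ∃ r C K σ : ℝ, 0 < r ∧ 0 < C ∧ 0 < K ∧ 0 < σ ∧ σ < 1 ∧
      ∀ (x z : Vec n) (v : ℕ → Vec m), ‖x - z‖ ≤ r → ∃ v' : ℕ → Vec m, ∀ t,
        ‖predict g x v' t - predict g z v t‖ ≤ C * σ ^ t * ‖x - z‖ ∧
        ‖v' t - v t‖ ≤ K * σ ^ t * ‖x - z‖ := by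
  obtain ⟨κ, V, cl, cu, δ, kmax, ρ, hcl, hcu, hδ, hk, hρ, hρ1, -, hVc, hV0, hV⟩ := h
  have hC : 0 < √(cu / cl) := Real.sqrt_pos.2 (div_pos hcu hcl)
  -- The factor 2 in the radius makes `cu * ‖x - z‖ ^ 2 < δ` strict; the rate is `√ρ` because `V`
  -- behaves like a squared distance.
  refine ⟨√(δ / (2 * cu)), √(cu / cl), kmax * √(cu / cl), √ρ, Real.sqrt_pos.2 (by positivity),
    hC, mul_pos hk hC, Real.sqrt_pos.2 hρ, (Real.sqrt_lt' one_pos).2 (by simpa using hρ1), ?_⟩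
  intro x z v hxz
  have hxz2 : cu * ‖x - z‖ ^ 2 < δ := by
    have h1 : ‖x - z‖ ^ 2 ≤ δ / (2 * cu) := (Real.le_sqrt (norm_nonneg _) (by positivity)).1 hxz
    rw [le_div_iff₀ (by positivity)] at h1
    linarith
  let y : ℕ → Vec n := fun t =>
    Nat.rec x (fun t y => g y (κ y (predict g z v t) (v t))) t
  let v' : ℕ → Vec m := fun t => κ (y t) (predict g z v t) (v t)
  have hy : ∀ t, predict g x v' t = y t := by
    intro t
    induction t with
    | zero => rfl
    | succ t ih => simp only [predict, ih]; rfl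
  have hx : V x z (v 0) ≤ δ := le_of_quadratic_on_sublevel (hVc z (v 0)) (hV0 z (v 0)) hcu hδ
    (fun y hy => (hV y z (v 0) hy).2.1) hxz2
  -- Staying in the sublevel set is proved together with the decay, since the contraction holds only
  -- there. Its arbitrary last argument is taken to be the next target input.
  have hVt : ∀ t, V (y t) (predict g z v t) (v t) ≤ δ ∧
      V (y t) (predict g z v t) (v t) ≤ ρ ^ t * (cu * ‖x - z‖ ^ 2) := by
    intro t
    induction t with
    | zero => exact ⟨hx, by rw [pow_zero, one_mul]; exact (hV x z (v 0) hx).2.1⟩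
    | succ t ih =>
      have h1 := (hV _ _ _ ih.1).2.2.2 (v (t + 1))
      have h2 : V (y (t + 1)) (predict g z v (t + 1)) (v (t + 1)) ≤
        ρ * V (y t) (predict g z v t) (v t) := h1
      have h3 := mul_le_mul_of_nonneg_left ih.2 hρ.le
      have h4 := mul_le_mul_of_nonneg_left ih.1 hρ.le
      refine ⟨by nlinarith, h2.trans (h3.trans (le_of_eq (by ring)))⟩
  have hnorm : ∀ t, ‖y t - predict g z v t‖ ≤ √(cu / cl) * √ρ ^ t * ‖x - z‖ := by
    intro t
    have h1 := (hV _ _ _ (hVt t).1).1.trans (hVt t).2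
    refine abs_le_of_sq_le_sq' ?_ (by positivity) |>.2
    have h2 : (√(cu / cl) * √ρ ^ t * ‖x - z‖) ^ 2 = cu / cl * ρ ^ t * ‖x - z‖ ^ 2 := by
      rw [mul_pow, mul_pow, Real.sq_sqrt (by positivity), ← pow_mul, mul_comm t, pow_mul,
        Real.sq_sqrt hρ.le]
    rw [h2, ← mul_le_mul_iff_right₀ hcl]
    refine h1.trans (le_of_eq ?_)
    field_simp
  refine ⟨v', fun t => ⟨by rw [hy]; exact hnorm t, ?_⟩⟩
  have h1 := (hV _ _ _ (hVt t).1).2.2.1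
  refine h1.trans ((mul_le_mul_of_nonneg_left (hnorm t) hk.le).trans (le_of_eq (by ring)))

/-- By chaining along a segment, every state can be steered exponentially onto every trajectory. -/
theorem LocIncrStabilizable.exists_track_global (h : LocIncrStabilizable g) :
    ∃ C K σ : ℝ, 0 < C ∧ 0 < K ∧ 0 < σ ∧ σ < 1 ∧
      ∀ (x z : Vec n) (v : ℕ → Vec m), ∃ v' : ℕ → Vec m, ∀ t,
        ‖predict g x v' t - predict g z v t‖ ≤ C * σ ^ t * ‖x - z‖ ∧
        ‖v' t - v t‖ ≤ K * σ ^ t * ‖x - z‖ := by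
  obtain ⟨r, C, K, σ, hr, hC, hK, hσ, hσ1, htr⟩ := h.exists_track
  refine ⟨C, K, σ, hC, hK, hσ, hσ1, ?_⟩
  have key : ∀ (L : ℕ) (x z : Vec n) (v : ℕ → Vec m), ‖x - z‖ ≤ L * r → ∃ v' : ℕ → Vec m, ∀ t,
        ‖predict g x v' t - predict g z v t‖ ≤ C * σ ^ t * ‖x - z‖ ∧
        ‖v' t - v t‖ ≤ K * σ ^ t * ‖x - z‖ := by
    intro L
    induction L with
    | zero =>
      intro x z v hx
      have hxz : x = z := by simpa [sub_eq_zero] using hx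
      subst hxz
      exact ⟨v, fun t => by simp⟩
    | succ L ih =>
      intro x z v hx
      push_cast at hx
      have hL : (0 : ℝ) < L + 1 := by positivity
      set s : ℝ := L / (L + 1) with hs
      have hs0 : 0 ≤ s := by positivity
      have hs1 : 1 - s = 1 / (L + 1) := by rw [hs]; field_simp; ring
      have hs1' : 0 ≤ 1 - s := by rw [hs1]; positivity
      -- With `y` on the segment, `x` at distance at most `r` from it, track the `z`-trajectory from
      -- `y` and that trajectory from `x`. The lengths add up exactly, so the constants `C`, `K`,
      -- `σ` do not grow with the number of links.
      set y : Vec n := z + s • (x - z) with hy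
      have hyz : ‖y - z‖ = s * ‖x - z‖ := by
        rw [hy, add_sub_cancel_left, norm_smul, Real.norm_of_nonneg hs0]
      have hxy : ‖x - y‖ = (1 - s) * ‖x - z‖ := by
        rw [show x - y = (1 - s) • (x - z) by rw [hy]; module, norm_smul,
          Real.norm_of_nonneg hs1']
      obtain ⟨v₁, hv₁⟩ := ih y z v (by
        rw [hyz, hs, div_mul_eq_mul_div, div_le_iff₀ hL]
        nlinarith [(Nat.cast_nonneg L : (0 : ℝ) ≤ L)])
      obtain ⟨v₂, hv₂⟩ := htr x y v₁ (by
        rw [hxy, hs1, one_div_mul_eq_div, div_le_iff₀ hL]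
        linarith)
      refine ⟨v₂, fun t => ⟨?_, ?_⟩⟩
      · have h1 := norm_sub_le_norm_sub_add_norm_sub (predict g x v₂ t) (predict g y v₁ t)
          (predict g z v t)
        have h2 := (hv₁ t).1
        have h3 := (hv₂ t).1
        rw [hyz] at h2
        rw [hxy] at h3
        linarith
      · have h1 := norm_sub_le_norm_sub_add_norm_sub (v₂ t) (v₁ t) (v t)
        have h2 := (hv₁ t).2
        have h3 := (hv₂ t).2
        rw [hyz] at h2
        rw [hxy] at h3
        linarith
  intro x z v
  obtain ⟨L, hL⟩ := exists_nat_ge (‖x - z‖ / r)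
  exact key L x z v ((div_le_iff₀ hr).1 hL)

theorem IsFeasiblePeriodic.predict_eq {M : ℕ} {xr : ℕ → Vec n} {ur : ℕ → Vec m}
    (h : IsFeasiblePeriodic g M xr ur) (k t : ℕ) :
    predict g (xr k) (fun i => ur (k + i)) t = xr (k + t) := by
  induction t with
  | zero => rfl
  | succ t ih => simp only [predict, ih]; exact (h.2.1 (k + t)).symm

/-- Cost controllability, uniformly in the state, the time and the horizon. -/
theorem exists_cost_controllability (h : LocIncrStabilizable g)
    {Q : Matrix (Fin n) (Fin n) ℝ} {R : Matrix (Fin m) (Fin m) ℝ} (hQ : Q.PosDef) (hR : R.PosDef)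
    {M : ℕ} {xr : ℕ → Vec n} {ur : ℕ → Vec m} (hfeas : IsFeasiblePeriodic g M xr ur) :
    ∃ γ : ℝ, 1 ≤ γ ∧ ∀ x k, ∃ v, ∀ L, seqCost g Q R xr ur x v k L ≤ γ * wsq Q (x - xr k) := by
  obtain ⟨C, K, σ, hC, hK, hσ, hσ1, htr⟩ := h.exists_track_global
  obtain ⟨a, b, ha, hb, hab⟩ := exists_wsq_bounds hQ
  obtain ⟨a', b', ha', hb', hab'⟩ := exists_wsq_bounds hR
  set D : ℝ := b * C ^ 2 + b' * K ^ 2 with hD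
  have hD0 : 0 < D := by positivity
  have hσ2 : σ ^ 2 < 1 := pow_lt_one₀ hσ.le hσ1 two_ne_zero
  -- Squared tracking errors sum to a geometric series, which bounds every horizon at once; `a`
  -- converts the norm back to the `Q`-weight.
  refine ⟨max 1 (D / (1 - σ ^ 2) / a), le_max_left _ _, fun x k => ?_⟩
  obtain ⟨v, hv⟩ := htr x (xr k) fun i => ur (k + i)
  refine ⟨v, fun L => ?_⟩
  have hstage : ∀ t, stageCost Q R xr ur (predict g x v t) (v t) (k + t) ≤
      (σ ^ 2) ^ t * (D * ‖x - xr k‖ ^ 2) := by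
    intro t
    obtain ⟨h1, h2⟩ := hv t
    rw [hfeas.predict_eq] at h1
    have h3 := pow_le_pow_left₀ (norm_nonneg _) h1 2
    have h4 := pow_le_pow_left₀ (norm_nonneg _) h2 2
    have h5 := (hab (predict g x v t - xr (k + t))).2.trans (mul_le_mul_of_nonneg_left h3 hb.le)
    have h6 := (hab' (v t - ur (k + t))).2.trans (mul_le_mul_of_nonneg_left h4 hb'.le)
    rw [stageCost, hD, ← pow_mul, mul_comm 2 t, pow_mul]
    refine (add_le_add h5 h6).trans (le_of_eq (by ring))
  have hgeo : ∑ t ∈ Finset.range L, (σ ^ 2) ^ t ≤ 1 / (1 - σ ^ 2) := by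
    rw [one_div, ← tsum_geometric_of_lt_one (sq_nonneg σ) hσ2]
    exact (summable_geometric_of_lt_one (sq_nonneg σ) hσ2).sum_le_tsum _
      fun i _ => pow_nonneg (sq_nonneg σ) i
  calc seqCost g Q R xr ur x v k L
      ≤ ∑ t ∈ Finset.range L, (σ ^ 2) ^ t * (D * ‖x - xr k‖ ^ 2) :=
        Finset.sum_le_sum fun t _ => hstage t
    _ = (∑ t ∈ Finset.range L, (σ ^ 2) ^ t) * (D * ‖x - xr k‖ ^ 2) := by rw [Finset.sum_mul]
    _ ≤ 1 / (1 - σ ^ 2) * (D * ‖x - xr k‖ ^ 2) :=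
        mul_le_mul_of_nonneg_right hgeo (by positivity)
    _ = D / (1 - σ ^ 2) / a * (a * ‖x - xr k‖ ^ 2) := by field_simp
    _ ≤ D / (1 - σ ^ 2) / a * wsq Q (x - xr k) :=
        mul_le_mul_of_nonneg_left (hab _).1
          (div_nonneg (div_nonneg hD0.le (by linarith)) ha.le)
    _ ≤ _ := mul_le_mul_of_nonneg_right (le_max_right _ _) (wsq_nonneg hQ _)

end Controllability

end PEMPC

namespace PEMPC

/-! ### Existence of minimizers and regularity of the optimal cost. -/

section Value

variable {n m N : ℕ} {g : Vec n → Vec m → Vec n} {Q : Matrix (Fin n) (Fin n) ℝ}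
    {R : Matrix (Fin m) (Fin m) ℝ} {xr : ℕ → Vec n} {ur : ℕ → Vec m}

theorem continuous_extend (i : ℕ) : Continuous fun U : Fin N → Vec m => extend U i := by
  unfold extend
  split_ifs <;> fun_prop

theorem continuous_predict (hg : Continuous fun p : Vec n × Vec m => g p.1 p.2) (i : ℕ) :
    Continuous fun p : Vec n × (Fin N → Vec m) => predict g p.1 (extend p.2) i := by
  induction i with
  | zero => exact continuous_fst
  | succ i ih => exact hg.comp (ih.prodMk ((continuous_extend i).comp continuous_snd))

theorem continuous_cost (hg : Continuous fun p : Vec n × Vec m => g p.1 p.2) (k : ℕ) :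
    Continuous fun p : Vec n × (Fin N → Vec m) => cost g Q R xr ur N p.1 p.2 k := by
  unfold cost
  refine continuous_finsetSum _ fun i _ => ?_
  have h1 := continuous_predict (N := N) hg i
  exact ((continuous_wsq Q).comp (h1.sub continuous_const)).add
    ((continuous_wsq R).comp (by fun_prop))

theorem stage_le_cost (hQ : Q.PosDef) (hR : R.PosDef) (x : Vec n) (U : Fin N → Vec m) (k : ℕ)
    (i : Fin N) :
    wsq Q (predict g x (extend U) i - xr (k + i)) + wsq R (U i - ur (k + i)) ≤
      cost g Q R xr ur N x U k :=
  Finset.single_le_sum (f := fun i : Fin N =>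
    wsq Q (predict g x (extend U) i - xr (k + i)) + wsq R (U i - ur (k + i)))
    (fun _ _ => add_nonneg (wsq_nonneg hQ _) (wsq_nonneg hR _)) (Finset.mem_univ i)

theorem wsq_state_le_cost (hQ : Q.PosDef) (hR : R.PosDef) (hN : 0 < N) (x : Vec n)
    (U : Fin N → Vec m) (k : ℕ) : wsq Q (x - xr k) ≤ cost g Q R xr ur N x U k := by
  have h := stage_le_cost (g := g) (xr := xr) (ur := ur) hQ hR x U k ⟨0, hN⟩
  have h' := wsq_nonneg hR (U ⟨0, hN⟩ - ur (k + 0))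
  simp only [predict] at h
  exact (le_add_of_nonneg_right h').trans h

theorem cost_nonneg (hQ : Q.PosDef) (hR : R.PosDef) (x : Vec n) (U : Fin N → Vec m) (k : ℕ) :
    0 ≤ cost g Q R xr ur N x U k :=
  Finset.sum_nonneg fun _ _ => add_nonneg (wsq_nonneg hQ _) (wsq_nonneg hR _)

/-- Input sequences of bounded cost are bounded. -/
theorem dist_le_of_cost_le (hQ : Q.PosDef) (hR : R.PosDef) {a : ℝ} (ha : 0 < a)
    (haR : ∀ z, a * ‖z‖ ^ 2 ≤ wsq R z) {x : Vec n} {U : Fin N → Vec m} {k : ℕ} {c : ℝ}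
    (h : cost g Q R xr ur N x U k ≤ c) : dist U (fun i => ur (k + i)) ≤ √(c / a) := by
  refine (dist_pi_le_iff (Real.sqrt_nonneg _)).2 fun i => ?_
  rw [dist_eq_norm]
  refine Real.le_sqrt_of_sq_le ?_
  rw [le_div_iff₀ ha]
  have h1 := stage_le_cost (g := g) (xr := xr) (ur := ur) hQ hR x U k i
  have h2 := wsq_nonneg hQ (predict g x (extend U) i - xr (k + i))
  have h3 := haR (U i - ur (k + i))
  linarith

/-- Since `R` penalizes every input, the cost is coercive: sequences cheaper than the reference
inputs lie in a compact ball. -/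
theorem exists_isMinimizer (hg : Continuous fun p : Vec n × Vec m => g p.1 p.2) (hQ : Q.PosDef)
    (hR : R.PosDef) (x : Vec n) (k : ℕ) :
    ∃ U : Fin N → Vec m, IsMinimizer g Q R xr ur N x k U := by
  obtain ⟨a, _, ha, -, haR⟩ := exists_wsq_bounds hR
  have hcost := continuous_cost (N := N) (Q := Q) (R := R) (xr := xr) (ur := ur) hg k
  have hc : Continuous fun U : Fin N → Vec m => cost g Q R xr ur N x U k := by fun_prop
  obtain ⟨U, hU⟩ := hc.exists_forall_le' (fun i => ur (k + i)) (Filter.mem_of_superset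
    (isCompact_closedBall (fun i : Fin N => ur (k + i))
      √(cost g Q R xr ur N x (fun i => ur (k + i)) k / a)).compl_mem_cocompact
    fun U hU => le_of_not_gt fun hlt =>
      hU (dist_le_of_cost_le hQ hR ha (fun z => (haR z).1) hlt.le))
  exact ⟨U, hU⟩

/-- The optimal cost of the horizon-`N` problem. -/
noncomputable def value (g : Vec n → Vec m → Vec n) (Q : Matrix (Fin n) (Fin n) ℝ)
    (R : Matrix (Fin m) (Fin m) ℝ) (xr : ℕ → Vec n) (ur : ℕ → Vec m) (N : ℕ)
    (x : Vec n) (k : ℕ) : ℝ :=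
  ⨅ U : Fin N → Vec m, cost g Q R xr ur N x U k

theorem value_le_cost (hQ : Q.PosDef) (hR : R.PosDef) (x : Vec n) (k : ℕ) (U : Fin N → Vec m) :
    value g Q R xr ur N x k ≤ cost g Q R xr ur N x U k :=
  ciInf_le ⟨0, by rintro _ ⟨U, rfl⟩; exact cost_nonneg hQ hR x U k⟩ U

theorem value_le_seqCost (hQ : Q.PosDef) (hR : R.PosDef) (x : Vec n) (k : ℕ) (v : ℕ → Vec m) :
    value g Q R xr ur N x k ≤ seqCost g Q R xr ur x v k N := by
  rw [seqCost_eq_cost]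
  exact value_le_cost hQ hR x k _

theorem IsMinimizer.cost_eq_value (hQ : Q.PosDef) (hR : R.PosDef) {x : Vec n} {k : ℕ}
    {U : Fin N → Vec m} (hU : IsMinimizer g Q R xr ur N x k U) :
    cost g Q R xr ur N x U k = value g Q R xr ur N x k :=
  le_antisymm (le_ciInf hU) (value_le_cost hQ hR x k U)

theorem cost_periodic {M : ℕ} (hfeas : IsFeasiblePeriodic g M xr ur) (x : Vec n)
    (U : Fin N → Vec m) : Function.Periodic (cost g Q R xr ur N x U) M := by
  intro k
  unfold cost
  refine Finset.sum_congr rfl fun i _ => ?_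
  rw [add_right_comm, hfeas.2.2.1, hfeas.2.2.2]

theorem value_periodic {M : ℕ} (hfeas : IsFeasiblePeriodic g M xr ur) (x : Vec n) :
    Function.Periodic (value g Q R xr ur N x) M := by
  intro k
  unfold value
  exact congrArg iInf (funext fun U => cost_periodic hfeas x U k)

theorem IsFeasiblePeriodic.xr_mod {M : ℕ} (hfeas : IsFeasiblePeriodic g M xr ur) (k : ℕ) :
    xr (k % M) = xr k :=
  Function.Periodic.map_mod_nat (f := xr) hfeas.2.2.1 k

theorem IsFeasiblePeriodic.ur_mod {M : ℕ} (hfeas : IsFeasiblePeriodic g M xr ur) (k : ℕ) :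
    ur (k % M) = ur k :=
  Function.Periodic.map_mod_nat (f := ur) hfeas.2.2.2 k

/-- On sublevel sets the optimal cost is upper semicontinuous, uniformly in state and time. -/
theorem exists_value_le_add (hg : Continuous fun p : Vec n × Vec m => g p.1 p.2) (hQ : Q.PosDef)
    (hR : R.PosDef) {M : ℕ} (hfeas : IsFeasiblePeriodic g M xr ur) (hN : 0 < N) (c : ℝ) {ε : ℝ}
    (hε : 0 < ε) :
    ∃ δ > 0, ∀ k x y, value g Q R xr ur N x k ≤ c → ‖y - x‖ ≤ δ →
      value g Q R xr ur N y k ≤ value g Q R xr ur N x k + ε := by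
  obtain ⟨a, _, ha, -, haQ⟩ := exists_wsq_bounds hQ
  obtain ⟨b, _, hb, -, hbR⟩ := exists_wsq_bounds hR
  have hk : ∀ k, ∀ᶠ δ in 𝓝[>] (0 : ℝ), ∀ x y, value g Q R xr ur N x k ≤ c → ‖y - x‖ ≤ δ →
      value g Q R xr ur N y k ≤ value g Q R xr ur N x k + ε := by
    intro k
    -- This compact set contains all states of the sublevel set, with a margin of 1 for the
    -- perturbed state, and all their minimizers. A minimizer at `x` is then used as a candidate at
    -- `y`.
    have huc := ((isCompact_closedBall (xr k) (√(c / a) + 1)).prod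
      (isCompact_closedBall (fun i : Fin N => ur (k + i)) √(c / b))).uniformContinuousOn_of_continuous
      (continuous_cost (Q := Q) (R := R) (xr := xr) (ur := ur) hg k).continuousOn
    obtain ⟨δ, hδ, hδ'⟩ := Metric.uniformContinuousOn_iff.1 huc ε hε
    filter_upwards [Ioo_mem_nhdsGT (lt_min hδ one_pos)] with d hd x y hx hxy
    obtain ⟨U, hU⟩ := exists_isMinimizer (N := N) (xr := xr) (ur := ur) hg hQ hR x k
    have hval := hU.cost_eq_value hQ hR
    rw [← hval] at hx
    have hUm : U ∈ Metric.closedBall (fun i : Fin N => ur (k + i)) √(c / b) :=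
      dist_le_of_cost_le hQ hR hb (fun z => (hbR z).1) hx
    have hxr : dist x (xr k) ≤ √(c / a) := by
      rw [dist_eq_norm]
      refine Real.le_sqrt_of_sq_le ?_
      rw [le_div_iff₀ ha, mul_comm]
      exact (haQ _).1.trans ((wsq_state_le_cost hQ hR hN x U k).trans hx)
    have hyx : dist y x < min δ 1 := by
      rw [dist_eq_norm]; exact hxy.trans_lt hd.2
    have hyr : dist y (xr k) ≤ √(c / a) + 1 := by
      have := dist_triangle y x (xr k)
      have := hyx.trans_le (min_le_right _ _)
      linarith
    have h := hδ' (y, U) ⟨hyr, hUm⟩ (x, U) ⟨hxr.trans (by linarith), hUm⟩ (by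
      rw [Prod.dist_eq, dist_self, max_eq_left dist_nonneg]
      exact hyx.trans_le (min_le_left _ _))
    rw [Real.dist_eq] at h
    have h1 := (abs_lt.1 h).2
    have h2 := value_le_cost (g := g) (xr := xr) (ur := ur) hQ hR y k U
    simp only at h1
    linarith
  -- By periodicity only `M` times matter, so one `δ` serves all of them.
  have hall : ∀ᶠ δ in 𝓝[>] (0 : ℝ), ∀ k : Fin M, ∀ x y, value g Q R xr ur N x k ≤ c →
      ‖y - x‖ ≤ δ → value g Q R xr ur N y k ≤ value g Q R xr ur N x k + ε :=
    eventually_all.2 fun k => hk k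
  obtain ⟨δ, hδ, hδ0⟩ := (hall.and self_mem_nhdsWithin).exists
  refine ⟨δ, hδ0, fun k x y hx hxy => ?_⟩
  have h := hδ ⟨k % M, Nat.mod_lt _ hfeas.1⟩ x y
  simp only [(value_periodic hfeas _).map_mod_nat] at h
  exact h hx hxy

end Value

end PEMPC

namespace PEMPC

/-! ### Robustness of persistent excitation. -/

section Excitation

variable {n m S : ℕ}

/-- By `|v a * v b| ≤ (v a ^ 2 + v b ^ 2) / 2`, entries bounded by `η` give a quadratic form bounded
by `η * S * |v|²`. -/
theorem posSemidef_smul_one_add {D : Matrix (Fin S) (Fin S) ℝ} (hD : D.IsHermitian) {η t : ℝ}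
    (hη : ∀ a b, |D a b| ≤ η) (ht : η * S ≤ t) :
    (t • (1 : Matrix (Fin S) (Fin S) ℝ) + D).PosSemidef := by
  refine Matrix.PosSemidef.of_dotProduct_mulVec_nonneg
    ((Matrix.isHermitian_one.smul (by simp [IsSelfAdjoint])).add hD) fun v => ?_
  have h1 : ∀ a b, -(η * ((v a ^ 2 + v b ^ 2) / 2)) ≤ v a * (D a b * v b) := by
    intro a b
    have h2 : |v a * (D a b * v b)| ≤ η * ((v a ^ 2 + v b ^ 2) / 2) := by
      rw [show v a * (D a b * v b) = D a b * (v a * v b) by ring, abs_mul]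
      refine mul_le_mul (hη a b) ?_ (abs_nonneg _) ((abs_nonneg _).trans (hη a b))
      rw [abs_le]
      constructor <;> nlinarith [sq_nonneg (v a + v b), sq_nonneg (v a - v b)]
    exact (abs_le.1 h2).1
  have h3 : ∑ a, ∑ b, -(η * ((v a ^ 2 + v b ^ 2) / 2)) = -(η * S * ∑ a, v a ^ 2) := by
    simp only [Finset.sum_neg_distrib, ← Finset.mul_sum, ← Finset.sum_div,
      Finset.sum_add_distrib, Finset.sum_const, Finset.card_univ, Fintype.card_fin, nsmul_eq_mul]
    ring
  have h4 : v ⬝ᵥ D.mulVec v = ∑ a, ∑ b, v a * (D a b * v b) := by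
    simp only [dotProduct, Matrix.mulVec, Finset.mul_sum]
  have h5 : v ⬝ᵥ v = ∑ a, v a ^ 2 := by simp only [dotProduct, sq]
  have h6 := Finset.sum_le_sum fun a (_ : a ∈ Finset.univ) =>
    Finset.sum_le_sum fun b (_ : b ∈ Finset.univ) => h1 a b
  rw [h3, ← h4] at h6
  have h7 : η * S * ∑ a, v a ^ 2 ≤ t * ∑ a, v a ^ 2 :=
    mul_le_mul_of_nonneg_right ht (Finset.sum_nonneg fun _ _ => sq_nonneg _)
  rw [star_trivial, Matrix.add_mulVec, dotProduct_add, Matrix.smul_mulVec, Matrix.one_mulVec,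
    dotProduct_smul, h5, smul_eq_mul]
  linarith

/-- The information matrix `φ φᵀ`. -/
def gram (fb : Fin S → Vec n → Vec m → Vec n) (x : Vec n) (u : Vec m) :
    Matrix (Fin S) (Fin S) ℝ :=
  regressor fb x u * (regressor fb x u).transpose

theorem isHermitian_gram (fb : Fin S → Vec n → Vec m → Vec n) (x : Vec n) (u : Vec m) :
    (gram fb x u).IsHermitian :=
  Matrix.isHermitian_mul_conjTranspose_self _

theorem continuous_gram_apply {fb : Fin S → Vec n → Vec m → Vec n}
    (hfb : ∀ j, Continuous fun p : Vec n × Vec m => fb j p.1 p.2) (a b : Fin S) :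
    Continuous fun p : Vec n × Vec m => gram fb p.1 p.2 a b := by
  simp only [gram, regressor, Matrix.mul_apply, Matrix.transpose_apply, Matrix.of_apply]
  refine continuous_finsetSum _ fun i _ => ?_
  have := hfb a
  have := hfb b
  fun_prop

theorem IsFeasiblePeriodic.exists_gram_near {g : Vec n → Vec m → Vec n} {M : ℕ} {xr : ℕ → Vec n}
    {ur : ℕ → Vec m} (hfeas : IsFeasiblePeriodic g M xr ur)
    {fb : Fin S → Vec n → Vec m → Vec n}
    (hfb : ∀ j, Continuous fun p : Vec n × Vec m => fb j p.1 p.2) {ε : ℝ} (hε : 0 < ε) :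
    ∃ δ > 0, ∀ k x u, ‖x - xr k‖ ≤ δ → ‖u - ur k‖ ≤ δ → ∀ a b,
      |gram fb x u a b - gram fb (xr k) (ur k) a b| ≤ ε := by
  have hk : ∀ k a b, ∀ᶠ δ in 𝓝[>] (0 : ℝ), ∀ x u, ‖x - xr k‖ ≤ δ → ‖u - ur k‖ ≤ δ →
      |gram fb x u a b - gram fb (xr k) (ur k) a b| ≤ ε := by
    intro k a b
    obtain ⟨δ, hδ, h⟩ := Metric.continuous_iff.1 (continuous_gram_apply hfb a b) (xr k, ur k) ε hε
    filter_upwards [Ioo_mem_nhdsGT hδ] with d hd x u hx hu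
    have := h (x, u) (by
      rw [Prod.dist_eq, dist_eq_norm, dist_eq_norm]
      exact max_lt (hx.trans_lt hd.2) (hu.trans_lt hd.2))
    rw [Real.dist_eq] at this
    exact this.le
  have hall : ∀ᶠ δ in 𝓝[>] (0 : ℝ), ∀ (k : Fin M) a b, ∀ x u, ‖x - xr k‖ ≤ δ →
      ‖u - ur k‖ ≤ δ → |gram fb x u a b - gram fb (xr k) (ur k) a b| ≤ ε :=
    eventually_all.2 fun k => eventually_all.2 fun a => eventually_all.2 fun b => hk k a b
  obtain ⟨δ, hδ, hδ0⟩ := (hall.and self_mem_nhdsWithin).exists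
  refine ⟨δ, hδ0, fun k x u hx hu a b => ?_⟩
  have h := hδ ⟨k % M, Nat.mod_lt _ hfeas.1⟩ a b x u
  simp only [hfeas.xr_mod, hfeas.ur_mod] at h
  exact h hx hu

/-- Persistent excitation of the reference is inherited by all sequences close to it. -/
theorem IsPEFrom.exists_of_near {g : Vec n → Vec m → Vec n} {M : ℕ} {xr : ℕ → Vec n}
    {ur : ℕ → Vec m} (hfeas : IsFeasiblePeriodic g M xr ur)
    {fb : Fin S → Vec n → Vec m → Vec n}
    (hfb : ∀ j, Continuous fun p : Vec n × Vec m => fb j p.1 p.2) (hPE : IsPEFrom fb M 0 xr ur) :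
    ∃ δ > 0, ∀ (k₀ : ℕ) (x : ℕ → Vec n) (u : ℕ → Vec m),
      (∀ k ≥ k₀, ‖x k - xr k‖ ≤ δ ∧ ‖u k - ur k‖ ≤ δ) → IsPEFrom fb M k₀ x u := by
  obtain ⟨α, β, hα, hβ, hαβ⟩ := hPE
  -- Chosen so that `M` entrywise errors of size `ε` shift the quadratic form by at most `α / 2`;
  -- the `+ 1` covers `S = 0`.
  set ε : ℝ := α / 2 / (M * S + 1) with hε
  have hε0 : 0 < ε := by positivity
  obtain ⟨δ, hδ, hnear⟩ := hfeas.exists_gram_near hfb hε0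
  refine ⟨δ, hδ, fun k₀ x u hxu => ⟨α / 2, β + α / 2, by positivity, by positivity,
    fun j hj => ?_⟩⟩
  set A := ∑ i ∈ Finset.range M, regressor fb (x (j + i)) (u (j + i)) *
    (regressor fb (x (j + i)) (u (j + i))).transpose with hA
  set B := ∑ i ∈ Finset.range M, regressor fb (xr (j + i)) (ur (j + i)) *
    (regressor fb (xr (j + i)) (ur (j + i))).transpose with hB
  have hAB : ∀ a b, |(A - B) a b| ≤ M * ε := by
    intro a b
    rw [hA, hB, ← Finset.sum_sub_distrib, Matrix.sum_apply]
    refine (Finset.abs_sum_le_sum_abs _ _).trans ?_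
    refine (Finset.sum_le_card_nsmul _ _ ε fun i _ => ?_).trans (by simp)
    have h := hxu (j + i) (by omega)
    exact hnear (j + i) _ _ h.1 h.2 a b
  have hAh : A.IsHermitian := isSelfAdjoint_sum _ fun i _ => isHermitian_gram fb _ _
  have hBh : B.IsHermitian := isSelfAdjoint_sum _ fun i _ => isHermitian_gram fb _ _
  have ht : M * ε * S ≤ α / 2 := by
    rw [hε, show (M : ℝ) * (α / 2 / (M * S + 1)) * S = α / 2 * (M * S) / (M * S + 1) by ring,
      div_le_iff₀ (by positivity)]
    nlinarith
  obtain ⟨h1, h2⟩ := hαβ j (Nat.zero_le j)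
  constructor
  -- `A - (α/2) I = (B - α I) + ((α/2) I + (A - B))`, and similarly for the upper bound.
  · convert h1.add (posSemidef_smul_one_add (hAh.sub hBh) hAB ht) using 1
    module
  · convert h2.add (posSemidef_smul_one_add (hBh.sub hAh)
      (fun a b => (abs_sub_comm _ _).trans_le (hAB a b)) ht) using 1
    module

end Excitation

/-! ### Practical stability under disturbances. -/

section ClosedLoop

variable {n m N : ℕ} {g : Vec n → Vec m → Vec n} {Q : Matrix (Fin n) (Fin n) ℝ}
    {R : Matrix (Fin m) (Fin m) ℝ} {xr : ℕ → Vec n} {ur : ℕ → Vec m}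

/-- If the optimal cost contracts along the nominal closed loop, then small disturbances keep small
sublevel sets invariant, and closed-loop sequences from a given sublevel set reach them. -/
theorem exists_ultimate_bound (hg : Continuous fun p : Vec n × Vec m => g p.1 p.2) (hQ : Q.PosDef)
    (hR : R.PosDef) {M : ℕ} (hfeas : IsFeasiblePeriodic g M xr ur) (hN : 0 < N) {η : ℝ}
    (hη : 0 ≤ η) (hη1 : η < 1)
    (hstep : ∀ (x : Vec n) (k : ℕ) (U : Fin N → Vec m), IsMinimizer g Q R xr ur N x k U →
      value g Q R xr ur N (g x (U ⟨0, hN⟩)) (k + 1) ≤ η * value g Q R xr ur N x k)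
    (c : ℝ) {r : ℝ} (hr : 0 < r) :
    ∃ wbar > 0, ∀ (x : ℕ → Vec n) (u : ℕ → Vec m) (w : ℕ → Vec n),
      IsClosedLoop g Q R xr ur N x u w → (∀ k, ‖w k‖ ≤ wbar) →
      (value g Q R xr ur N (x 0) 0 ≤ c →
        ∃ K, ∀ k ≥ K, value g Q R xr ur N (x k) k ≤ r) ∧
      (value g Q R xr ur N (x 0) 0 ≤ r → ∀ k, value g Q R xr ur N (x k) k ≤ r) := by
  have hη' : 0 < 1 - η := sub_pos.2 hη1
  have hC : 0 < max c r := lt_max_of_lt_right hr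
  obtain ⟨δ, hδ, hadd⟩ := exists_value_le_add (Q := Q) (R := R) hg hQ hR hfeas hN (max c r)
    -- With this error the recursion `V⁺ ≤ η V + ε` has fixed point `r / 2`, leaving room to enter
    -- the level `r` in finite time.
    (ε := (1 - η) * (r / 2)) (by positivity)
  refine ⟨δ, hδ, fun x u w hcl hw => ?_⟩
  have hnext : ∀ k, value g Q R xr ur N (x k) k ≤ max c r →
      value g Q R xr ur N (x (k + 1)) (k + 1) ≤
        η * value g Q R xr ur N (x k) k + (1 - η) * (r / 2) := by
    intro k hk
    obtain ⟨⟨_, U, hU, hu⟩, hx⟩ := hcl k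
    have h1 := hstep (x k) k U hU
    rw [← hu] at h1
    have h2 : η * value g Q R xr ur N (x k) k ≤ max c r :=
      (mul_le_mul_of_nonneg_left hk hη).trans (mul_le_of_le_one_left hC.le hη1.le)
    have h3 := hadd (k + 1) (g (x k) (u k)) (x (k + 1)) (h1.trans h2) (by
      rw [hx, add_sub_cancel_left]; exact hw k)
    linarith
  -- Needed for `b = max c r`, so that the recursion applies at all times, and for `b = r`, the
  -- invariance claimed.
  have hinv : ∀ b, r ≤ b → b ≤ max c r → value g Q R xr ur N (x 0) 0 ≤ b →
      ∀ k, value g Q R xr ur N (x k) k ≤ b := by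
    intro b hrb hb h0 k
    induction k with
    | zero => exact h0
    | succ k ih =>
      have h1 := hnext k (ih.trans hb)
      have h2 := mul_le_mul_of_nonneg_left ih hη
      have h3 : (1 - η) * (r / 2) ≤ (1 - η) * b :=
        mul_le_mul_of_nonneg_left (by linarith) hη'.le
      linarith
  refine ⟨fun h0 => ?_, hinv r le_rfl (le_max_right _ _)⟩
  have hbd := hinv _ (le_max_right _ _) le_rfl (h0.trans (le_max_left _ _))
  have hdecay : ∀ k, value g Q R xr ur N (x k) k ≤ η ^ k * max c r + r / 2 := by
    intro k
    induction k with
    | zero => have := hbd 0; rw [pow_zero]; linarith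
    | succ k ih =>
      have h1 := hnext k (hbd k)
      have h2 := mul_le_mul_of_nonneg_left ih hη
      rw [pow_succ]
      linarith
  have hlim : Tendsto (fun k : ℕ => η ^ k * max c r) atTop (𝓝 0) := by
    simpa using (tendsto_pow_atTop_nhds_zero_of_lt_one hη hη1).mul_const (max c r)
  obtain ⟨K, hK⟩ := eventually_atTop.1 (hlim.eventually_lt_const (half_pos hr))
  exact ⟨K, fun k hk => by linarith [hdecay k, hK k hk]⟩

end ClosedLoop

end PEMPC

/-! ### Assembly of the main theorem. -/

theorem mainTheorem6 {n m S : ℕ}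
    (f₀ : PEMPC.Vec n → PEMPC.Vec m → PEMPC.Vec n)
    (fb : Fin S → PEMPC.Vec n → PEMPC.Vec m → PEMPC.Vec n)
    (θ : PEMPC.Vec S)
    (hf₀ : ContDiff ℝ 2 (fun p : PEMPC.Vec n × PEMPC.Vec m => f₀ p.1 p.2))
    (hfb : ∀ j, ContDiff ℝ 2 (fun p : PEMPC.Vec n × PEMPC.Vec m => fb j p.1 p.2))
    (Q : Matrix (Fin n) (Fin n) ℝ) (R : Matrix (Fin m) (Fin m) ℝ)
    (hQ : Q.PosDef) (hR : R.PosDef)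
    (M : ℕ) (xr : ℕ → PEMPC.Vec n) (ur : ℕ → PEMPC.Vec m)
    (hfeas : PEMPC.IsFeasiblePeriodic (PEMPC.dyn f₀ fb θ) M xr ur)
    (hPE : PEMPC.IsPEFrom fb M 0 xr ur)
    (hHess : ∀ N : ℕ, 1 ≤ N → PEMPC.HessianPosDef (PEMPC.dyn f₀ fb θ) Q R xr ur N)
    (hstab : PEMPC.LocIncrStabilizable (PEMPC.dyn f₀ fb θ))
    (cx : ℝ) (hcx : 0 < cx) :
    ∃ N₀ : ℕ, 1 ≤ N₀ ∧ ∀ N : ℕ, N₀ ≤ N →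
      (∀ (x : PEMPC.Vec n) (k : ℕ), ∃ U : Fin N → PEMPC.Vec m,
        PEMPC.IsMinimizer (PEMPC.dyn f₀ fb θ) Q R xr ur N x k U) ∧
      ∃ wbar : ℝ, 0 < wbar ∧
        ∀ (x : ℕ → PEMPC.Vec n) (u : ℕ → PEMPC.Vec m) (w : ℕ → PEMPC.Vec n),
          PEMPC.IsClosedLoop (PEMPC.dyn f₀ fb θ) Q R xr ur N x u w →
          ‖x 0 - xr 0‖ ≤ cx → (∀ k, ‖w k‖ ≤ wbar) →
          ∃ kPE : ℕ, PEMPC.IsPEFrom fb M kPE x u ∧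
            ∀ kbar : ℕ, kPE ≤ kbar → kbar % M = 0 →
              ∀ (x' : ℕ → PEMPC.Vec n) (u' : ℕ → PEMPC.Vec m) (w' : ℕ → PEMPC.Vec n),
                PEMPC.IsClosedLoop (PEMPC.dyn f₀ fb θ) Q R xr ur N x' u' w' →
                x' 0 = x kbar → (∀ k, ‖w' k‖ ≤ wbar) →
                PEMPC.IsPEFrom fb M 0 x' u' := by
  set g := PEMPC.dyn f₀ fb θ with hgdef
  have hfbc : ∀ j, Continuous fun p : PEMPC.Vec n × PEMPC.Vec m => fb j p.1 p.2 :=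
    fun j => (hfb j).continuous
  have hg : Continuous fun p : PEMPC.Vec n × PEMPC.Vec m => g p.1 p.2 := by
    simp only [hgdef, PEMPC.dyn]
    refine hf₀.continuous.add (continuous_finsetSum _ fun j _ => ?_)
    have := hfbc j
    fun_prop
  obtain ⟨γ, hγ, hB⟩ := PEMPC.exists_cost_controllability hstab hQ hR hfeas
  obtain ⟨a, b, ha, hb, hab⟩ := PEMPC.exists_wsq_bounds hQ
  obtain ⟨a', _, ha', -, hab'⟩ := PEMPC.exists_wsq_bounds hR
  obtain ⟨δ, hδ, hnear⟩ := hPE.exists_of_near hfeas hfbc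
  have hγ0 : 0 < γ := by linarith
  have hq0 : 0 ≤ 1 - 1 / γ := by rw [sub_nonneg, div_le_one hγ0]; exact hγ
  have hq1 : 1 - 1 / γ < 1 := by linarith [one_div_pos.2 hγ0]
  have hlim : Tendsto (fun p : ℕ => γ ^ 2 * (1 - 1 / γ) ^ p) atTop (𝓝 0) := by
    simpa using (tendsto_pow_atTop_nhds_zero_of_lt_one hq0 hq1).const_mul (γ ^ 2)
  obtain ⟨p₀, hp₀⟩ := eventually_atTop.1 (hlim.eventually_lt_const one_half_pos)
  refine ⟨p₀ + 2, by omega, fun N hN => ⟨PEMPC.exists_isMinimizer hg hQ hR, ?_⟩⟩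
  obtain ⟨p, rfl⟩ : ∃ p, N = p + 2 := ⟨N - 2, by omega⟩
  have hstep : ∀ (x : PEMPC.Vec n) (k : ℕ) (U : Fin (p + 2) → PEMPC.Vec m),
      PEMPC.IsMinimizer g Q R xr ur (p + 2) x k U →
      PEMPC.value g Q R xr ur (p + 2) (g x (U ⟨0, by omega⟩)) (k + 1) ≤
        (1 - 1 / (2 * γ)) * PEMPC.value g Q R xr ur (p + 2) x k := by
    intro x k U hU
    obtain ⟨v', hv'⟩ := PEMPC.exists_seqCost_decrease hQ hR hγ hB
      (hp₀ (p + 1) (by omega)).le x k (PEMPC.extend U) (fun v' => by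
        rw [← PEMPC.cost_eq_seqCost, PEMPC.seqCost_eq_cost]
        exact hU _)
    rw [← PEMPC.cost_eq_seqCost, hU.cost_eq_value hQ hR] at hv'
    exact (PEMPC.value_le_seqCost hQ hR _ _ v').trans hv'
  have hη1 : 1 / (2 * γ) ≤ 1 := by rw [div_le_one (by positivity)]; linarith
  have hη2 : 0 < 1 / (2 * γ) := by positivity
  -- The first level bounds the optimal cost of all admissible initial states. The target level is
  -- small enough that a stage cost below it puts state and input within `δ` of the reference.
  obtain ⟨wbar, hwbar, hmain⟩ := PEMPC.exists_ultimate_bound hg hQ hR hfeas (by omega)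
    (sub_nonneg.2 hη1) (by linarith) hstep (γ * (b * cx ^ 2)) (r := min a a' * δ ^ 2)
    (by positivity)
  have hclose : ∀ (x : ℕ → PEMPC.Vec n) (u : ℕ → PEMPC.Vec m) (w : ℕ → PEMPC.Vec n) (k₀ : ℕ),
      PEMPC.IsClosedLoop g Q R xr ur (p + 2) x u w →
      (∀ k ≥ k₀, PEMPC.value g Q R xr ur (p + 2) (x k) k ≤ min a a' * δ ^ 2) →
      PEMPC.IsPEFrom fb M k₀ x u := by
    intro x u w k₀ hcl hval
    refine hnear k₀ x u fun k hk => ?_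
    obtain ⟨⟨h0, U, hU, hu⟩, -⟩ := hcl k
    have h1 := PEMPC.stage_le_cost (g := g) (xr := xr) (ur := ur) hQ hR (x k) U k ⟨0, h0⟩
    rw [hU.cost_eq_value hQ hR, ← hu] at h1
    change PEMPC.wsq Q (x k - xr k) + PEMPC.wsq R (u k - ur k) ≤ _ at h1
    have h2 := hval k hk
    have h3 := PEMPC.wsq_nonneg hQ (x k - xr k)
    have h4 := PEMPC.wsq_nonneg hR (u k - ur k)
    have h5 : min a a' * δ ^ 2 ≤ a * δ ^ 2 :=
      mul_le_mul_of_nonneg_right (min_le_left _ _) (sq_nonneg _)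
    have h6 : min a a' * δ ^ 2 ≤ a' * δ ^ 2 :=
      mul_le_mul_of_nonneg_right (min_le_right _ _) (sq_nonneg _)
    have h7 := (hab (x k - xr k)).1
    have h8 := (hab' (u k - ur k)).1
    exact ⟨(sq_le_sq₀ (norm_nonneg _) hδ.le).1 (le_of_mul_le_mul_left (by linarith) ha),
      (sq_le_sq₀ (norm_nonneg _) hδ.le).1 (le_of_mul_le_mul_left (by linarith) ha')⟩
  refine ⟨wbar, hwbar, fun x u w hcl hx0 hw => ?_⟩
  have hv0 : PEMPC.value g Q R xr ur (p + 2) (x 0) 0 ≤ γ * (b * cx ^ 2) := by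
    obtain ⟨v, hv⟩ := hB (x 0) 0
    refine (PEMPC.value_le_seqCost hQ hR _ _ v).trans ((hv _).trans ?_)
    refine mul_le_mul_of_nonneg_left ((hab _).2.trans ?_) hγ0.le
    exact mul_le_mul_of_nonneg_left (pow_le_pow_left₀ (norm_nonneg _) hx0 2) hb.le
  obtain ⟨K, hK⟩ := (hmain x u w hcl hw).1 hv0
  refine ⟨K, hclose x u w K hcl hK, fun kbar hkbar hmod x' u' w' hcl' hx' hw' => ?_⟩
  refine hclose x' u' w' 0 hcl' fun k _ => (hmain x' u' w' hcl' hw').2 ?_ k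
  -- As `kbar` is a multiple of the period, restarting the clock at 0 leaves the optimal cost
  -- unchanged, so the restarted loop begins in the invariant sublevel set.
  rw [hx', ← hmod, (PEMPC.value_periodic hfeas _).map_mod_nat]
  exact hK kbar hkbar
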